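/- Consider linear bilevel problems with rational data $G,g,c,d,f,C,D,b$. Let $X=\{x : Gx\ge g\}$, for each $x$ let $S(x)$ be the set of optimal solutions of the follower's problem $\min_y\{f^\top y : Cx+Dy\ge b\}$, and consider the optimistic bilevel problem without coupling constraints $$\min_{x\in X}\ F_{\mathrm o}(x):=c^\top x+\min_y\{d^\top y : y\in S(x)\}.$$ Assume that $X\neq\emptyset$, that $\{y : Cx+Dy\ge b\}$ is non-empty and compact for every $x\in X$, and that $F_{\mathrm o}$ is bounded from below on $X$. For $\kappa>0$ consider the pessimistic bilevel problem without coupling constraints $$\min_{(x,\bar y)\in\tilde X}\ c^\top x+d^\top\bar y+\max_{y,\varepsilon}\{\kappa\varepsilon : (y,\varepsilon)\in\tilde S(x,\bar y)\},$$ where $\tilde X=\{(x,\bar y) : x\in X,\ Cx+D\bar y\ge b\}$ and $\tilde S(x,\bar y)$ is the set of optimal solutions of $$\min_{y,\varepsilon}\ f^\top y\quad\text{s.t.}\quad Cx+Dy\ge b,\quad f^\top\bar y-f^\top y=\varepsilon,\quad \varepsilon\ge 0 .$$ Then there is a polynomial $p$ such that for every such problem (of any dimensions) there is a rational $\kappa>0$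 whose binary encoding length is at most $p(L)$, where $L$ is the binary encoding length of the data $(G,g,c,d,f,C,D,b)$, for which the optimistic and the pessimistic problem have the same globally optimal solutions in the following sense: the set of globally optimal $x$ of the optimistic problem is the projection onto the $x$-space of the set of globally optimal $(x,\bar y)$ of the pessimistic problem. More precisely, $(x,\bar y)$ is globally optimal for the pessimistic problem if and only if $x$ is globally optimal for the optimistic problem and $\bar y\in\operatorname{argmin}_y\{d^\top y : y\in S(x)\}$. -/

import Mathlib

noncomputable section

/-- Encoding length of a rational `p/q` in lowest terms: one sign bit, plus the binary lengths
`⌈log₂ (|p| + 1)⌉` and `⌈log₂ (q + 1)⌉` of numerator and denominator. -/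
def ratBitSize (q : ℚ) : ℕ :=
  1 + Nat.size q.num.natAbs + Nat.size q.den

/-- Encoding length of a rational vector. -/
def vecBitSize {n : ℕ} (v : Fin n → ℚ) : ℕ :=
  n + ∑ i, ratBitSize (v i)

/-- Encoding length of a rational matrix. -/
def matBitSize {m n : ℕ} (A : Matrix (Fin m) (Fin n) ℚ) : ℕ :=
  m * n + ∑ i, ∑ j, ratBitSize (A i j)

/-- The set of global minimizers of `g` over `s`. -/
def globalMinimizers {α β : Type*} [Preorder β] (s : Set α) (g : α → β) : Set α :=
  {z | z ∈ s ∧ ∀ z' ∈ s, g z ≤ g z'}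

/-- The rational data of a linear bilevel problem without coupling constraints: `nx` leader
variables, `ny` follower variables, the leader's polyhedron `X = {x | G x ≥ g}` given by `k`
inequalities, the leader's objective `cᵀ x + dᵀ y`, and the follower's problem
`min fᵀ y` subject to the `m` inequalities `C x + D y ≥ b`. -/
structure LinearBilevel (nx ny k m : ℕ) where
  G : Matrix (Fin k) (Fin nx) ℚ
  g : Fin k → ℚ
  c : Fin nx → ℚ
  d : Fin ny → ℚ
  f : Fin ny → ℚ
  C : Matrix (Fin m) (Fin nx) ℚ
  D : Matrix (Fin m) (Fin ny) ℚ
  b : Fin m → ℚ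

namespace LinearBilevel

variable {nx ny k m : ℕ} (P : LinearBilevel nx ny k m)

/-- Encoding length of the problem's data. -/
def bitSize : ℕ :=
  matBitSize P.G + vecBitSize P.g + vecBitSize P.c + vecBitSize P.d + vecBitSize P.f
    + matBitSize P.C + matBitSize P.D + vecBitSize P.b

/-- The leader's polyhedron `X`. -/
def X : Set (Fin nx → ℝ) :=
  {x | ∀ i, (P.g i : ℝ) ≤ ∑ j, (P.G i j : ℝ) * x j}

/-- `cᵀ x`. -/
def cVal (x : Fin nx → ℝ) : ℝ := ∑ j, (P.c j : ℝ) * x j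

/-- `dᵀ y`. -/
def dVal (y : Fin ny → ℝ) : ℝ := ∑ j, (P.d j : ℝ) * y j

/-- `fᵀ y`. -/
def fVal (y : Fin ny → ℝ) : ℝ := ∑ j, (P.f j : ℝ) * y j

/-- The follower's feasible set `{y | C x + D y ≥ b}`. -/
def lowerFeasible (x : Fin nx → ℝ) : Set (Fin ny → ℝ) :=
  {y | ∀ i, (P.b i : ℝ) ≤ ∑ j, (P.C i j : ℝ) * x j + ∑ j, (P.D i j : ℝ) * y j}

/-- `S(x)`, the set of optimal solutions of the follower's problem. -/
def S (x : Fin nx → ℝ) : Set (Fin ny → ℝ) :=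
  globalMinimizers (P.lowerFeasible x) P.fVal

/-- The optimistic objective `F_o(x) = cᵀ x + min {dᵀ y | y ∈ S(x)}`, with values in the
extended reals (so a minimum over the empty set is `+∞`). -/
def optimisticObjective (x : Fin nx → ℝ) : EReal :=
  (P.cVal x : EReal) + ⨅ y ∈ P.S x, (P.dVal y : EReal)

/-- The globally optimal solutions of the optimistic problem. -/
def optimisticSolutions : Set (Fin nx → ℝ) :=
  globalMinimizers P.X P.optimisticObjective

/-- `X̃`, the set of `(x, ȳ)` with `x ∈ X` and `ȳ` lower-level feasible for `x`. -/
def XTilde : Set ((Fin nx → ℝ) × (Fin ny → ℝ)) :=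
  {p | p.1 ∈ P.X ∧ p.2 ∈ P.lowerFeasible p.1}

/-- The feasible `(y, ε)` of the modified follower's problem:
`C x + D y ≥ b`, `fᵀ ȳ - fᵀ y = ε`, `ε ≥ 0`. -/
def epsLowerFeasible (x : Fin nx → ℝ) (ybar : Fin ny → ℝ) : Set ((Fin ny → ℝ) × ℝ) :=
  {q | q.1 ∈ P.lowerFeasible x ∧ P.fVal ybar - P.fVal q.1 = q.2 ∧ 0 ≤ q.2}

/-- `S̃(x, ȳ)`, the set of optimal `(y, ε)` of the modified follower's problem, whose objective
is `fᵀ y`. -/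
def STilde (x : Fin nx → ℝ) (ybar : Fin ny → ℝ) : Set ((Fin ny → ℝ) × ℝ) :=
  globalMinimizers (P.epsLowerFeasible x ybar) (fun q => P.fVal q.1)

/-- The pessimistic objective `cᵀ x + dᵀ ȳ + max {κ ε | (y, ε) ∈ S̃(x, ȳ)}`. -/
def pessimisticObjective (κ : ℝ) (p : (Fin nx → ℝ) × (Fin ny → ℝ)) : EReal :=
  ((P.cVal p.1 + P.dVal p.2 : ℝ) : EReal)
    + ⨆ q ∈ P.STilde p.1 p.2, ((κ * q.2 : ℝ) : EReal)

/-- The globally optimal solutions `(x, ȳ)` of the pessimistic problem. -/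
def pessimisticSolutions (κ : ℝ) : Set ((Fin nx → ℝ) × (Fin ny → ℝ)) :=
  globalMinimizers P.XTilde (P.pessimisticObjective κ)

/-- The standing assumptions (rationality of the data is built into `LinearBilevel`). -/
structure StandingAssumptions : Prop where
  lower_nonempty : ∀ x ∈ P.X, (P.lowerFeasible x).Nonempty
  lower_compact : ∀ x ∈ P.X, IsCompact (P.lowerFeasible x)
  X_nonempty : P.X.Nonempty
  bounded_below : ∃ M : ℝ, ∀ x ∈ P.X, (M : EReal) ≤ P.optimisticObjective x

end LinearBilevel

end

/-! All points of `STilde x ȳ` share the same `ε`, namely the follower's optimality gap of `ȳ`. The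
pessimistic objective is therefore `cᵀx + dᵀȳ + κ · gap`, a penalty form of the constraint `ȳ ∈
S(x)`, and the theorem says that this penalty is exact for a `κ` of polynomial size.

For fixed `x`, let `φ` be the follower's optimal value. An optimistic response `y₀` solves the
linear program `min {dᵀy | Dy ≥ b - Cx, -fᵀy ≥ -φ}`. If `μ` is the multiplier of the last row, then
`dᵀy₀ ≤ dᵀy + μ · gap(y)` for every feasible `y` (`exists_gap_multiplier`), so any `κ > μ` makes the
optimistic responses the only minimizers over `ȳ` (`pessimisticSolutions_eq`).

One `κ` serves all real `x` because `x` enters only the right-hand side. By Farkas and Carathéodory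
the multipliers can be supported on linearly independent rows (`exists_multipliers_of_isMinOn`), and
Cramer's rule then bounds them in terms of `D`, `f`, `d` alone by `2 ^ (4 L²)`
(`abs_multiplier_le`). -/

/-! ### Finitely generated cones, Farkas' lemma and linear programming multipliers. -/

/-- **Conic Carathéodory**: a nonnegative combination of a finite family of vectors is a nonnegative
combination of a linearly independent subfamily. -/
theorem exists_linearIndepOn_nonneg_combination {ι E : Type*} [AddCommGroup E] [Module ℝ E]
    (v : ι → E) (s : Finset ι) (t : ι → ℝ) (ht : ∀ i ∈ s, 0 ≤ t i) :
    ∃ s' ⊆ s, ∃ t' : ι → ℝ, (∀ i ∈ s', 0 ≤ t' i) ∧ LinearIndepOn ℝ v (s' : Set ι) ∧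
      ∑ i ∈ s', t' i • v i = ∑ i ∈ s, t i • v i := by
  classical
  induction s using Finset.strongInduction generalizing t with
  | H s ih =>
    by_cases hs : LinearIndepOn ℝ v (s : Set ι)
    · exact ⟨s, subset_rfl, t, ht, hs, rfl⟩
    obtain ⟨g, hg, j, hjs, hj⟩ : ∃ g : ι → ℝ, ∑ i ∈ s, g i • v i = 0 ∧ ∃ j ∈ s, 0 < g j := by
      rw [linearIndepOn_finset_iff] at hs
      push Not at hs
      obtain ⟨g, hg, j, hjs, hj⟩ := hs
      rcases lt_or_gt_of_ne hj with h | h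
      · exact ⟨-g, by simp [hg], j, hjs, by simpa using h⟩
      · exact ⟨g, hg, j, hjs, h⟩
    -- Ratio test: the minimal ratio is the largest multiple of the relation `g` that can be
    -- subtracted with all coefficients staying nonnegative, and it makes the coefficient of `i₀`
    -- vanish.
    obtain ⟨i₀, hi₀, hmin⟩ := ({i ∈ s | 0 < g i} : Finset ι).exists_min_image
      (fun i => t i / g i) ⟨j, by simp [hjs, hj]⟩
    rw [Finset.mem_filter] at hi₀
    obtain ⟨hi₀s, hgi₀⟩ := hi₀
    set r := t i₀ / g i₀ with hr
    have hr0 : 0 ≤ r := div_nonneg (ht _ hi₀s) hgi₀.le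
    have hzero : t i₀ - r * g i₀ = 0 := by rw [hr]; field_simp; ring
    have hnonneg : ∀ i ∈ s.erase i₀, 0 ≤ t i - r * g i := by
      intro i hi
      have his := Finset.mem_of_mem_erase hi
      rcases lt_or_ge 0 (g i) with h | h
      · have := hmin i (by simp [his, h])
        rw [le_div_iff₀ h] at this
        linarith
      · have := mul_nonpos_of_nonneg_of_nonpos hr0 h
        linarith [ht i his]
    obtain ⟨s', hs', t', ht', hind, hsum⟩ :=
      ih (s.erase i₀) (Finset.erase_ssubset hi₀s) (fun i => t i - r * g i) hnonneg
    refine ⟨s', hs'.trans (Finset.erase_subset _ _), t', ht', hind, hsum.trans ?_⟩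
    rw [Finset.sum_erase _ (by rw [hzero, zero_smul])]
    simp only [sub_smul, mul_smul, Finset.sum_sub_distrib, ← Finset.smul_sum, hg, smul_zero,
      sub_zero]

/-- The cone generated by a linearly independent family is closed. -/
theorem isClosed_nonneg_combinations_of_linearIndepOn {ι : Type*} {n : ℕ} (v : ι → Fin n → ℝ)
    (s : Finset ι) (hs : LinearIndepOn ℝ v (s : Set ι)) :
    IsClosed {w | ∃ t : ι → ℝ, (∀ i ∈ s, 0 ≤ t i) ∧ ∑ i ∈ s, t i • v i = w} := by
  classical
  let φ : (s → ℝ) →ₗ[ℝ] (Fin n → ℝ) := Fintype.linearCombination ℝ fun i : s => v i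
  have hinj : LinearMap.ker φ = ⊥ :=
    LinearMap.ker_eq_bot.2 (hs.fintypeLinearCombination_injective)
  have hcl := (LinearMap.isClosedEmbedding_of_injective hinj).isClosedMap
    {t | ∀ i, 0 ≤ t i} (by
      simp only [Set.ofPred_forall]
      exact isClosed_iInter fun i => isClosed_le continuous_const (continuous_apply i))
  convert hcl using 1
  ext w
  constructor
  · rintro ⟨t, ht, rfl⟩
    exact ⟨fun i => t i, fun i => ht i i.2, 
      Finset.sum_coe_sort s fun i => t i • v i⟩
  · rintro ⟨t, ht, rfl⟩
    refine ⟨fun i => if h : i ∈ s then t ⟨i, h⟩ else 0, fun i hi => by simpa [hi] using ht ⟨i, hi⟩,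
      ?_⟩
    rw [← Finset.sum_coe_sort]
    simp [φ, Fintype.linearCombination_apply]

/-- Finitely generated cones are closed. -/
theorem isClosed_nonneg_combinations {ι : Type*} {n : ℕ} (v : ι → Fin n → ℝ) (s : Finset ι) :
    IsClosed {w | ∃ t : ι → ℝ, (∀ i ∈ s, 0 ≤ t i) ∧ ∑ i ∈ s, t i • v i = w} := by
  classical
  have : {w | ∃ t : ι → ℝ, (∀ i ∈ s, 0 ≤ t i) ∧ ∑ i ∈ s, t i • v i = w} =
      ⋃ s' ∈ ({s' ∈ s.powerset | LinearIndepOn ℝ v (s' : Set ι)} : Finset (Finset ι)),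
        {w | ∃ t : ι → ℝ, (∀ i ∈ s', 0 ≤ t i) ∧ ∑ i ∈ s', t i • v i = w} := by
    ext w
    simp only [Finset.mem_filter, Finset.mem_powerset, Set.mem_iUnion, exists_prop,
      Set.mem_ofPred_eq]
    constructor
    · rintro ⟨t, ht, rfl⟩
      obtain ⟨s', hs', t', ht', hind, hsum⟩ := exists_linearIndepOn_nonneg_combination v s t ht
      exact ⟨s', ⟨hs', hind⟩, t', ht', hsum⟩
    · rintro ⟨s', ⟨hs', -⟩, t, ht, rfl⟩
      refine ⟨fun i => if i ∈ s' then t i else 0, fun i _ => ?_, ?_⟩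
      · dsimp only
        split_ifs with h
        exacts [ht i h, le_rfl]
      · simp only [ite_smul, zero_smul]
        rw [Finset.sum_ite_mem, Finset.inter_eq_right.2 hs']
  rw [this]
  exact Set.Finite.isClosed_biUnion (Finset.finite_toSet _) fun s' hs' =>
    isClosed_nonneg_combinations_of_linearIndepOn v s' (Finset.mem_filter.1 hs').2

open Matrix in
/-- **Farkas' lemma** for finitely generated cones. -/
theorem exists_nonneg_combination_of_forall_dotProduct {ι : Type*} {n : ℕ} (v : ι → Fin n → ℝ)
    (s : Finset ι) (w : Fin n → ℝ)
    (h : ∀ z : Fin n → ℝ, (∀ i ∈ s, 0 ≤ v i ⬝ᵥ z) → 0 ≤ w ⬝ᵥ z) :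
    ∃ t : ι → ℝ, (∀ i ∈ s, 0 ≤ t i) ∧ ∑ i ∈ s, t i • v i = w := by
  classical
  let K : ProperCone ℝ (Fin n → ℝ) :=
    { carrier := {w | ∃ t : ι → ℝ, (∀ i ∈ s, 0 ≤ t i) ∧ ∑ i ∈ s, t i • v i = w}
      add_mem' := by
        rintro _ _ ⟨t, ht, rfl⟩ ⟨u, hu, rfl⟩
        exact ⟨t + u, fun i hi => add_nonneg (ht i hi) (hu i hi), by
          simp [add_smul, Finset.sum_add_distrib]⟩
      zero_mem' := ⟨0, by simp, by simp⟩
      smul_mem' := by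
        rintro c _ ⟨t, ht, rfl⟩
        exact ⟨fun i => c.1 * t i, fun i hi => mul_nonneg c.2 (ht i hi), by
          simp only [mul_smul, ← Finset.smul_sum]; rfl⟩
      isClosed' := isClosed_nonneg_combinations v s }
  by_contra hw
  obtain ⟨l, hl, hlw⟩ := K.hyperplane_separation_point (x₀ := w) hw
  have hdot : ∀ y : Fin n → ℝ, l y = y ⬝ᵥ fun j => l (Pi.single j 1) := by
    intro y
    conv_lhs => rw [pi_eq_sum_univ' y]
    simp [dotProduct, map_sum]
  have := h (fun j => l (Pi.single j 1)) fun i hi => by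
    rw [← hdot]
    refine hl _ ⟨Pi.single i 1, fun k _ => ?_, ?_⟩
    · by_cases hk : k = i
      · subst hk; simp
      · simp [Pi.single_eq_of_ne hk]
    · simp [Pi.single_apply, hi]
  rw [← hdot] at this
  linarith

open Matrix in
/-- Optimality conditions of a linear program: at a minimizer, the objective is a nonnegative
combination of linearly independent active constraints. -/
theorem exists_multipliers_of_isMinOn {ι : Type*} [Fintype ι] {n : ℕ} (a : ι → Fin n → ℝ)
    (β : ι → ℝ) (c y : Fin n → ℝ) (hy : ∀ i, β i ≤ a i ⬝ᵥ y)
    (hmin : ∀ z, (∀ i, β i ≤ a i ⬝ᵥ z) → c ⬝ᵥ y ≤ c ⬝ᵥ z) :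
    ∃ (s : Finset ι) (t : ι → ℝ), (∀ i ∈ s, a i ⬝ᵥ y = β i) ∧ (∀ i ∈ s, 0 ≤ t i) ∧
      LinearIndepOn ℝ a (s : Set ι) ∧ ∑ i ∈ s, t i • a i = c := by
  classical
  let s : Finset ι := {i | a i ⬝ᵥ y = β i}
  have hfarkas : ∀ z : Fin n → ℝ, (∀ i ∈ s, 0 ≤ a i ⬝ᵥ z) → 0 ≤ c ⬝ᵥ z := by
    intro z hz
    -- Short steps along `z` stay feasible: active constraints do not decrease, and inactive ones
    -- have slack.
    have hev : ∀ᶠ δ in nhdsWithin (0 : ℝ) (Set.Ioi 0), ∀ i, β i ≤ a i ⬝ᵥ (y + δ • z) := by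
      rw [Filter.eventually_all]
      intro i
      by_cases hi : a i ⬝ᵥ y = β i
      · filter_upwards [self_mem_nhdsWithin] with δ hδ
        rw [dotProduct_add, dotProduct_smul, hi, smul_eq_mul]
        have := mul_nonneg (le_of_lt hδ) (hz i (by simp [s, hi]))
        linarith
      · have hlt : β i < a i ⬝ᵥ y := lt_of_le_of_ne (hy i) (Ne.symm hi)
        have hcont : Continuous fun δ : ℝ => a i ⬝ᵥ y + δ * (a i ⬝ᵥ z) := by fun_prop
        have := (hcont.tendsto 0).eventually_const_lt (u := β i) (by simpa using hlt)
        filter_upwards [nhdsWithin_le_nhds this] with δ hδ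
        rw [dotProduct_add, dotProduct_smul, smul_eq_mul]
        exact hδ.le
    obtain ⟨δ, hδ, hδ0⟩ := (hev.and self_mem_nhdsWithin).exists
    have := hmin _ hδ
    rw [dotProduct_add, dotProduct_smul, smul_eq_mul] at this
    exact nonneg_of_mul_nonneg_right (by linarith) hδ0
  obtain ⟨t, ht, hsum⟩ := exists_nonneg_combination_of_forall_dotProduct a s c hfarkas
  obtain ⟨s', hs', t', ht', hind, hsum'⟩ := exists_linearIndepOn_nonneg_combination a s t ht
  exact ⟨s', t', fun i hi => (Finset.mem_filter.1 (hs' hi)).2, ht', hind, hsum'.trans hsum⟩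

/-! ### Size bounds: Cramer's rule and common denominators. -/

open Matrix in
/-- Cramer's rule for the Gram matrix bounds the coefficients of an integral vector with respect to
linearly independent integral vectors. -/
theorem abs_coeff_le_of_integral {ι : Type*} [Fintype ι] {n : ℕ} (A : Matrix ι (Fin n) ℤ)
    (w : Fin n → ℤ) (B : ℕ) (hA : ∀ i j, |A i j| ≤ B) (hw : ∀ j, |w j| ≤ B)
    (hind : LinearIndependent ℝ fun i j => (A i j : ℝ)) (t : ι → ℝ)
    (ht : ∀ j, ∑ i, t i * (A i j : ℝ) = w j) (i : ι) :
    |t i| ≤ ((Fintype.card ι).factorial * (n * B ^ 2) ^ Fintype.card ι : ℕ) := by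
  classical
  -- `A` need not be square; multiplying the system by `A` gives a square integral one, nonsingular
  -- because the rows are independent over `ℝ`.
  let M : Matrix ι ι ℤ := A * Aᵀ
  let u : ι → ℤ := A *ᵥ w
  let AR : Matrix ι (Fin n) ℝ := A.map Int.cast
  have hMR : M.map (Int.cast : ℤ → ℝ) = AR * ARᵀ := by
    ext i j; simp [M, AR, Matrix.mul_apply]
  have hARt : ARᵀ *ᵥ t = fun j => (w j : ℝ) := by
    ext j
    simp only [mulVec, dotProduct, transpose_apply, AR, map_apply]
    rw [← ht j]
    exact Finset.sum_congr rfl fun i _ => mul_comm _ _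
  have hMt : (AR * ARᵀ) *ᵥ t = fun i => (u i : ℝ) := by
    rw [← mulVec_mulVec, hARt]
    ext i
    simp [u, AR, mulVec, dotProduct]
  have hdet : (AR * ARᵀ).det ≠ 0 := by
    intro h0
    obtain ⟨x, hx0, hx⟩ := exists_mulVec_eq_zero_iff.2 h0
    have h1 : ARᵀ *ᵥ x = 0 := by
      have := (self_mul_conjTranspose_mulVec_eq_zero AR x).1 (by simpa using hx)
      simpa using this
    refine hx0 (funext fun i => Fintype.linearIndependent_iff.1 hind x ?_ i)
    ext j
    have := congrFun h1 j
    simp only [mulVec, dotProduct, transpose_apply, AR, map_apply, Pi.zero_apply] at this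
    simp only [Finset.sum_apply, Pi.smul_apply, smul_eq_mul, Pi.zero_apply]
    rw [← this]
    exact Finset.sum_congr rfl fun i _ => mul_comm _ _
  have hdetM : ((M.det : ℤ) : ℝ) = (AR * ARᵀ).det := by
    rw [← hMR]
    exact Int.cast_det M
  have hcr : (M.det : ℝ) * t i = ((M.updateCol i u).det : ℤ) := by
    have h1 : cramer (AR * ARᵀ) ((AR * ARᵀ) *ᵥ t) = (AR * ARᵀ).det • t := by
      rw [cramer_eq_adjugate_mulVec, mulVec_mulVec, adjugate_mul, smul_mulVec, one_mulVec]
    have h2 := congrFun h1 i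
    rw [hMt, cramer_apply, Pi.smul_apply, smul_eq_mul, ← hdetM] at h2
    rw [← h2, Int.cast_det, ← hMR, map_updateCol]
    rfl
  have hentry : ∀ (p q : Fin n → ℤ), (∀ j, |p j| ≤ B) → (∀ j, |q j| ≤ B) →
      |p ⬝ᵥ q| ≤ ((n * B ^ 2 : ℕ) : ℤ) := by
    intro p q hp hq
    calc |p ⬝ᵥ q| ≤ ∑ j, |p j * q j| := Finset.abs_sum_le_sum_abs _ _
      _ ≤ ∑ _j : Fin n, (B : ℤ) * B := Finset.sum_le_sum fun j _ => by
          rw [abs_mul]; exact mul_le_mul (hp j) (hq j) (abs_nonneg _) (by positivity)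
      _ = ((n * B ^ 2 : ℕ) : ℤ) := by
          simp only [Finset.sum_const, Finset.card_univ, Fintype.card_fin, nsmul_eq_mul]
          push_cast
          ring
  have hbound : |(M.updateCol i u).det| ≤
      (((Fintype.card ι).factorial * (n * B ^ 2) ^ Fintype.card ι : ℕ) : ℤ) := by
    have := det_le (A := M.updateCol i u) (abv := AbsoluteValue.abs)
      (x := ((n * B ^ 2 : ℕ) : ℤ)) (fun k l => by
        rw [updateCol_apply]
        split_ifs
        · exact hentry _ _ (hA k) hw
        · exact hentry _ _ (hA k) (hA l))
    simpa using this
  -- A nonzero integer determinant has absolute value at least 1, so Cramer's denominator can be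
  -- dropped.
  have hone : (1 : ℝ) ≤ |(M.det : ℝ)| := by
    have : M.det ≠ 0 := fun h => hdet (by rw [← hdetM, h, Int.cast_zero])
    exact_mod_cast Int.one_le_abs this
  calc |t i| ≤ |(M.det : ℝ)| * |t i| := le_mul_of_one_le_left (abs_nonneg _) hone
    _ = |(((M.updateCol i u).det : ℤ) : ℝ)| := by rw [← abs_mul, hcr]
    _ ≤ _ := by exact_mod_cast hbound

/-- A finite family of rationals has a common denominator for which the numerators are bounded
exponentially in the total encoding length. -/
theorem exists_common_denominator {ι : Type*} [Fintype ι] (q : ι → ℚ) :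
    ∃ N : ℕ, 0 < N ∧ ∃ z : ι → ℤ, ∀ i, (N : ℚ) * q i = z i ∧
      |z i| ≤ ((2 ^ ∑ i, ratBitSize (q i) : ℕ) : ℤ) := by
  classical
  refine ⟨∏ i, (q i).den, Finset.prod_pos fun i _ => (q i).den_pos,
    fun i => (q i).num * ((∏ j ∈ Finset.univ.erase i, (q j).den : ℕ) : ℤ), fun i => ⟨?_, ?_⟩⟩
  · rw [← Finset.mul_prod_erase _ _ (Finset.mem_univ i)]
    conv_lhs => rw [Nat.cast_mul, mul_right_comm, Rat.den_mul_eq_num]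
    push_cast
    rfl
  · have h1 : (q i).num.natAbs ≤ 2 ^ ratBitSize (q i) :=
      (Nat.lt_size_self _).le.trans
        (Nat.pow_le_pow_right two_pos (by unfold ratBitSize; omega))
    have h2 : ∏ j ∈ Finset.univ.erase i, (q j).den ≤
        ∏ j ∈ Finset.univ.erase i, 2 ^ ratBitSize (q j) :=
      Finset.prod_le_prod' fun j _ => (Nat.lt_size_self _).le.trans
        (Nat.pow_le_pow_right two_pos (by unfold ratBitSize; omega))
    have h3 : (q i).num.natAbs * ∏ j ∈ Finset.univ.erase i, (q j).den ≤
        2 ^ ∑ i, ratBitSize (q i) := by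
      rw [← Finset.prod_pow_eq_pow_sum, ← Finset.mul_prod_erase _ _ (Finset.mem_univ i)]
      exact Nat.mul_le_mul h1 h2
    rw [abs_mul, Int.abs_eq_natAbs, Nat.abs_cast]
    exact_mod_cast h3

/-- The exponent `4 L²` collects `L²` from the factorial, `L²` from `n ^ r` and `2 L²` from the
squared entry bound. -/
theorem factorial_mul_pow_le {r n L : ℕ} (hr : r ≤ n) (hn : n ≤ L) :
    r.factorial * (n * (2 ^ L) ^ 2) ^ r ≤ 2 ^ (4 * L ^ 2) := by
  have hL : L ≤ 2 ^ L := Nat.lt_two_pow_self.le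
  have hrL := hr.trans hn
  calc r.factorial * (n * (2 ^ L) ^ 2) ^ r
      ≤ (2 ^ L) ^ L * ((2 ^ L) * (2 ^ L) ^ 2) ^ L := by
        refine Nat.mul_le_mul ?_ ?_
        · calc r.factorial ≤ r ^ r := Nat.factorial_le_pow r
            _ ≤ (2 ^ L) ^ r := Nat.pow_le_pow_left (hrL.trans hL) r
            _ ≤ (2 ^ L) ^ L := Nat.pow_le_pow_right (by positivity) hrL
        · calc (n * (2 ^ L) ^ 2) ^ r ≤ ((2 ^ L) * (2 ^ L) ^ 2) ^ r :=
                Nat.pow_le_pow_left (Nat.mul_le_mul_right _ (hn.trans hL)) r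
            _ ≤ _ := Nat.pow_le_pow_right (by positivity) hrL
    _ = 2 ^ (4 * L ^ 2) := by ring

theorem ratBitSize_two_pow (k : ℕ) : ratBitSize ((2 ^ k : ℕ) : ℚ) = k + 3 := by
  simp only [ratBitSize, Rat.num_natCast, Rat.den_natCast, Int.natAbs_natCast, Nat.size_pow,
    Nat.size_one]
  omega

/-! ### The gap multiplier of the follower's problem and its bound. -/

namespace LinearBilevel

variable {nx ny k m : ℕ} (P : LinearBilevel nx ny k m)

theorem continuous_dVal : Continuous P.dVal := by unfold dVal; fun_prop

theorem continuous_fVal : Continuous P.fVal := by unfold fVal; fun_prop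

/-- The entries of the data `D`, `f`, `d` that determine the penalty parameter. -/
def followerEntries : (Fin m × Fin ny) ⊕ (Fin ny ⊕ Fin ny) → ℚ :=
  Sum.elim (fun p => P.D p.1 p.2) (Sum.elim P.f P.d)

theorem sum_ratBitSize_followerEntries_le :
    ∑ i, ratBitSize (P.followerEntries i) ≤ P.bitSize := by
  simp only [followerEntries, Fintype.sum_sum_type, Fintype.sum_prod_type, Sum.elim_inl,
    Sum.elim_inr, bitSize, vecBitSize, matBitSize]
  omega

theorem ny_le_bitSize : ny ≤ P.bitSize := by
  simp only [bitSize, vecBitSize]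
  omega

/-- The rows of the linear program `min {dᵀ y | D y ≥ b - C x, -fᵀ y ≥ -φ(x)}`. -/
def constraintRow : Option (Fin m) → Fin ny → ℝ
  | none => fun j => -(P.f j : ℝ)
  | some i => fun j => (P.D i j : ℝ)

open Matrix

theorem constraintRow_none_dotProduct (y : Fin ny → ℝ) :
    P.constraintRow none ⬝ᵥ y = -P.fVal y := by
  simp [constraintRow, dotProduct, fVal]

theorem constraintRow_some_dotProduct (i : Fin m) (y : Fin ny → ℝ) :
    P.constraintRow (some i) ⬝ᵥ y = ∑ j, (P.D i j : ℝ) * y j := rfl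

/-- The coefficients of `d` with respect to linearly independent constraint rows are at most
exponential in the square of the encoding length. -/
theorem abs_multiplier_le (s : Finset (Option (Fin m))) (t : Option (Fin m) → ℝ)
    (hind : LinearIndepOn ℝ P.constraintRow (s : Set (Option (Fin m))))
    (hsum : ∑ i ∈ s, t i • P.constraintRow i = fun j => (P.d j : ℝ))
    (i : Option (Fin m)) (hi : i ∈ s) : |t i| ≤ 2 ^ (4 * P.bitSize ^ 2) := by
  obtain ⟨N, hN, z, hz⟩ := exists_common_denominator P.followerEntries
  have hzL : ∀ e, |z e| ≤ ((2 ^ P.bitSize : ℕ) : ℤ) := fun e =>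
    (hz e).2.trans (by
      exact_mod_cast Nat.pow_le_pow_right two_pos P.sum_ratBitSize_followerEntries_le)
  have hzR : ∀ e, (N : ℝ) * (P.followerEntries e : ℝ) = z e := fun e => by
    exact_mod_cast congrArg (Rat.cast : ℚ → ℝ) (hz e).1
  -- Clearing denominators scales the rows and `d` by the same `N`, so the multipliers `t` are
  -- unchanged.
  let A : Matrix s (Fin ny) ℤ := fun i j =>
    i.1.elim (-z (.inr (.inl j))) fun l => z (.inl (l, j))
  have hAR : ∀ (i : s) j, (A i j : ℝ) = N * P.constraintRow i j := by
    rintro ⟨_ | l, hl⟩ j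
    · simpa [A, constraintRow, followerEntries] using (hzR (.inr (.inl j))).symm
    · simpa [A, constraintRow, followerEntries] using (hzR (.inl (l, j))).symm
  have hA : ∀ i j, |A i j| ≤ ((2 ^ P.bitSize : ℕ) : ℤ) := by
    rintro ⟨_ | l, hl⟩ j
    · simpa [A] using hzL (.inr (.inl j))
    · simpa [A] using hzL (.inl (l, j))
  have hN0 : (N : ℝ) ≠ 0 := by exact_mod_cast hN.ne'
  have hindA : LinearIndependent ℝ fun (i : s) j => (A i j : ℝ) := by
    have := LinearIndependent.units_smul (v := fun i : s => P.constraintRow i) hind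
      (fun _ => Units.mk0 (N : ℝ) hN0)
    convert this using 1
    funext i j
    rw [hAR]
    rfl
  have ht : ∀ j, ∑ i : s, t i * (A i j : ℝ) = z (.inr (.inr j)) := by
    intro j
    have h1 := congrFun hsum j
    simp only [Finset.sum_apply, Pi.smul_apply, smul_eq_mul] at h1
    rw [← hzR]
    simp only [followerEntries, Sum.elim_inr]
    rw [← h1, Finset.mul_sum, ← Finset.sum_coe_sort s]
    exact Finset.sum_congr rfl fun i _ => by rw [hAR]; ring
  have hcard : Fintype.card s ≤ ny := by
    simpa using LinearIndependent.fintype_card_le_finrank hindA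
  refine (abs_coeff_le_of_integral A (fun j => z (.inr (.inr j))) (2 ^ P.bitSize) hA
    (fun j => hzL _) hindA (fun i => t i) ht ⟨i, hi⟩).trans ?_
  exact_mod_cast factorial_mul_pow_le hcard P.ny_le_bitSize

/-- Exactness of the penalty: moving away from the follower's optimal face improves `dᵀ y` by at
most a bounded multiple of the follower's optimality gap. -/
theorem exists_gap_multiplier (x : Fin nx → ℝ) (y₀ : Fin ny → ℝ)
    (hy₀ : y₀ ∈ globalMinimizers (P.S x) P.dVal) :
    ∃ μ : ℝ, μ ≤ 2 ^ (4 * P.bitSize ^ 2) ∧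
      ∀ y ∈ P.lowerFeasible x, P.dVal y₀ ≤ P.dVal y + μ * (P.fVal y - P.fVal y₀) := by
  classical
  obtain ⟨⟨hfeas, hfmin⟩, hdmin⟩ := hy₀
  let β : Option (Fin m) → ℝ := fun i =>
    i.elim (-P.fVal y₀) fun l => (P.b l : ℝ) - ∑ j, (P.C l j : ℝ) * x j
  have hβ : ∀ y, (∀ i, β i ≤ P.constraintRow i ⬝ᵥ y) ↔
      y ∈ P.lowerFeasible x ∧ P.fVal y ≤ P.fVal y₀ := by
    intro y
    rw [Option.forall, and_comm]
    simp only [β, Option.elim, constraintRow_none_dotProduct, constraintRow_some_dotProduct,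
      neg_le_neg_iff, sub_le_iff_le_add', lowerFeasible, Set.mem_ofPred_eq]
  obtain ⟨s, t, hact, ht, hind, hsum⟩ := exists_multipliers_of_isMinOn P.constraintRow β
    -- A point feasible for this program has follower value at most that of `y₀`, hence lies in
    -- `S(x)`, where `y₀` minimizes `dVal`.
    (fun j => (P.d j : ℝ)) y₀ ((hβ y₀).2 ⟨hfeas, le_rfl⟩) (fun z hz => by
      obtain ⟨hz1, hz2⟩ := (hβ z).1 hz
      exact hdmin z ⟨hz1, fun w hw => hz2.trans (hfmin w hw)⟩)
  -- If the objective row is not in the support, its multiplier is 0.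
  refine ⟨if none ∈ s then t none else 0, ?_, fun y hy => ?_⟩
  · split_ifs with h
    · exact (le_abs_self _).trans (P.abs_multiplier_le s t hind hsum none h)
    · positivity
  have hd : P.dVal y - P.dVal y₀ = ∑ i ∈ s, t i * (P.constraintRow i ⬝ᵥ (y - y₀)) := by
    have : P.dVal y - P.dVal y₀ = (fun j => (P.d j : ℝ)) ⬝ᵥ (y - y₀) := by
      rw [dotProduct_sub]; rfl
    rw [this, ← hsum, sum_dotProduct]
    simp only [smul_dotProduct, smul_eq_mul]
  -- Rows of `D` in the support are active at `y₀` and satisfied at `y`, so their terms are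
  -- nonnegative; only the `none` term is kept.
  have hle : ∑ i ∈ s, (if i = none then t none * -(P.fVal y - P.fVal y₀) else 0) ≤
      ∑ i ∈ s, t i * (P.constraintRow i ⬝ᵥ (y - y₀)) := by
    refine Finset.sum_le_sum fun i hi => ?_
    rw [dotProduct_sub]
    cases i with
    | none =>
      rw [if_pos rfl, constraintRow_none_dotProduct, constraintRow_none_dotProduct]
      exact le_of_eq (by ring)
    | some l =>
      rw [if_neg (by simp), hact _ hi]
      refine mul_nonneg (ht _ hi) ?_
      have := hy l
      simp only [β, Option.elim, constraintRow_some_dotProduct]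
      linarith
  rw [← hd, Finset.sum_ite_eq' s none] at hle
  split_ifs at hle ⊢ <;> linarith

/-! ### Attainment, and comparison of the two objectives. -/

theorem S_nonempty {x : Fin nx → ℝ} (hne : (P.lowerFeasible x).Nonempty)
    (hc : IsCompact (P.lowerFeasible x)) : (P.S x).Nonempty := by
  obtain ⟨y, hy, hmin⟩ := hc.exists_isMinOn hne P.continuous_fVal.continuousOn
  exact ⟨y, hy, fun z hz => hmin hz⟩

theorem isCompact_S {x : Fin nx → ℝ} (hc : IsCompact (P.lowerFeasible x)) :
    IsCompact (P.S x) := by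
  have : P.S x = P.lowerFeasible x ∩ ⋂ z ∈ P.lowerFeasible x, {y | P.fVal y ≤ P.fVal z} := by
    ext y
    simp [S, globalMinimizers]
  rw [this]
  exact hc.inter_right (isClosed_biInter fun z _ =>
    isClosed_le P.continuous_fVal continuous_const)

theorem argmin_dVal_nonempty {x : Fin nx → ℝ} (hne : (P.lowerFeasible x).Nonempty)
    (hc : IsCompact (P.lowerFeasible x)) : (globalMinimizers (P.S x) P.dVal).Nonempty := by
  obtain ⟨y, hy, hmin⟩ := (P.isCompact_S hc).exists_isMinOn (P.S_nonempty hne hc)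
    P.continuous_dVal.continuousOn
  exact ⟨y, hy, fun z hz => hmin hz⟩

theorem optimisticObjective_eq {x : Fin nx → ℝ} {y : Fin ny → ℝ}
    (hy : y ∈ globalMinimizers (P.S x) P.dVal) :
    P.optimisticObjective x = ((P.cVal x + P.dVal y : ℝ) : EReal) := by
  rw [optimisticObjective, EReal.coe_add]
  congr 1
  exact le_antisymm (iInf₂_le y hy.1)
    (le_iInf₂ fun z hz => EReal.coe_le_coe_iff.2 (hy.2 z hz))

/-- The inner maximum is over a constant: minimizers of the modified follower's problem all have
value `P.fVal y₀`, since `y₀` itself is feasible there, and `ε` is determined by that value. -/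
theorem pessimisticObjective_eq (κ : ℝ) {x : Fin nx → ℝ} {y y₀ : Fin ny → ℝ}
    (hy : y ∈ P.lowerFeasible x) (hy₀ : y₀ ∈ P.S x) :
    P.pessimisticObjective κ (x, y) =
      ((P.cVal x + P.dVal y + κ * (P.fVal y - P.fVal y₀) : ℝ) : EReal) := by
  rw [pessimisticObjective, EReal.coe_add (P.cVal x + P.dVal y)]
  refine congrArg _ ?_
  have hmem : (y₀, P.fVal y - P.fVal y₀) ∈ P.STilde x y :=
    ⟨⟨hy₀.1, rfl, sub_nonneg.2 (hy₀.2 y hy)⟩, fun q hq => hy₀.2 q.1 hq.1⟩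
  refine le_antisymm (iSup₂_le fun q hq => ?_) (le_iSup₂_of_le _ hmem le_rfl)
  have h1 : P.fVal q.1 ≤ P.fVal y₀ := hq.2 _ hmem.1
  have h2 : P.fVal y₀ ≤ P.fVal q.1 := hy₀.2 _ hq.1.1
  rw [← hq.1.2.1, le_antisymm h1 h2]

/-- If the penalty dominates all gap multipliers, then for every `x` the pessimistic objective is
minimized over `ȳ` exactly by the optimistic responses, where it agrees with the optimistic
objective. -/
theorem pessimisticSolutions_eq {κ : ℝ}
    (hκ : 2 ^ (4 * P.bitSize ^ 2) < κ)
    (hne : ∀ x ∈ P.X, (globalMinimizers (P.S x) P.dVal).Nonempty) :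
    P.pessimisticSolutions κ =
      {q | q.1 ∈ P.optimisticSolutions ∧ q.2 ∈ globalMinimizers (P.S q.1) P.dVal} := by
  have heq : ∀ x y, y ∈ globalMinimizers (P.S x) P.dVal →
      P.pessimisticObjective κ (x, y) = P.optimisticObjective x := fun x y hy => by
    rw [P.pessimisticObjective_eq κ hy.1.1 hy.1, P.optimisticObjective_eq hy, sub_self, mul_zero,
      add_zero]
  have hge : ∀ x y, x ∈ P.X → y ∈ P.lowerFeasible x →
      P.optimisticObjective x ≤ P.pessimisticObjective κ (x, y) ∧
        (P.pessimisticObjective κ (x, y) ≤ P.optimisticObjective x →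
          y ∈ globalMinimizers (P.S x) P.dVal) := by
    intro x y hx hy
    obtain ⟨y₀, hy₀⟩ := hne x hx
    obtain ⟨μ, hμ, hgap⟩ := P.exists_gap_multiplier x y₀ hy₀
    have hpen := hgap y hy
    have hf : 0 ≤ P.fVal y - P.fVal y₀ := sub_nonneg.2 (hy₀.1.2 y hy)
    have hmul : μ * (P.fVal y - P.fVal y₀) ≤ κ * (P.fVal y - P.fVal y₀) :=
      mul_le_mul_of_nonneg_right (hμ.trans hκ.le) hf
    rw [P.pessimisticObjective_eq κ hy hy₀.1, P.optimisticObjective_eq hy₀, EReal.coe_le_coe_iff,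
      EReal.coe_le_coe_iff]
    refine ⟨by linarith, fun hle => ?_⟩
    -- The strict inequality `μ < κ` matters here: a positive gap would cost more than it can gain
    -- in `dVal`.
    have hf0 : P.fVal y - P.fVal y₀ = 0 := by
      by_contra h
      have := mul_lt_mul_of_pos_right (hμ.trans_lt hκ) (lt_of_le_of_ne hf (Ne.symm h))
      linarith
    rw [hf0, mul_zero] at hle
    exact ⟨⟨hy, fun z hz => (sub_eq_zero.1 hf0).trans_le (hy₀.1.2 z hz)⟩,
      fun z hz => (by linarith : P.dVal y ≤ P.dVal y₀).trans (hy₀.2 z hz)⟩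
  ext ⟨x, y⟩
  constructor
  · rintro ⟨⟨hx, hy⟩, hmin⟩
    have hle : ∀ x' ∈ P.X, P.pessimisticObjective κ (x, y) ≤ P.optimisticObjective x' := by
      intro x' hx'
      obtain ⟨y', hy'⟩ := hne x' hx'
      rw [← heq x' y' hy']
      exact hmin (x', y') ⟨hx', hy'.1.1⟩
    exact ⟨⟨hx, fun x' hx' => (hge x y hx hy).1.trans (hle x' hx')⟩, (hge x y hx hy).2 (hle x hx)⟩
  · rintro ⟨⟨hx, hmin⟩, hy⟩
    refine ⟨⟨hx, hy.1.1⟩, ?_⟩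
    rintro ⟨x', y'⟩ ⟨hx', hy'⟩
    rw [heq x y hy]
    exact (hmin x' hx').trans (hge x' y' hx' hy').1

end LinearBilevel

theorem mainTheorem2 :
    ∃ p : Polynomial ℕ, ∀ (nx ny k m : ℕ) (P : LinearBilevel nx ny k m),
      P.StandingAssumptions →
        ∃ κ : ℚ, 0 < κ ∧ ratBitSize κ ≤ p.eval P.bitSize ∧
          P.optimisticSolutions = Prod.fst '' P.pessimisticSolutions (κ : ℝ) ∧
          P.pessimisticSolutions (κ : ℝ) =
            {q | q.1 ∈ P.optimisticSolutions ∧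
              q.2 ∈ globalMinimizers (P.S q.1) P.dVal} := by
  -- With `κ = 2 ^ (4 L² + 1)`, the extra factor 2 gives strict dominance over the multipliers, and
  -- the encoding length is `(4 L² + 1) + 3`.
  refine ⟨4 * Polynomial.X ^ 2 + 4, fun nx ny k m P hP => ?_⟩
  have hne : ∀ x ∈ P.X, (globalMinimizers (P.S x) P.dVal).Nonempty := fun x hx =>
    P.argmin_dVal_nonempty (hP.lower_nonempty x hx) (hP.lower_compact x hx)
  have hsol := P.pessimisticSolutions_eq
    (κ := (((2 ^ (4 * P.bitSize ^ 2 + 1) : ℕ) : ℚ) : ℝ))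
    (by push_cast; exact pow_lt_pow_right₀ one_lt_two (Nat.lt_succ_self _)) hne
  refine ⟨((2 ^ (4 * P.bitSize ^ 2 + 1) : ℕ) : ℚ), by positivity, ?_, ?_, hsol⟩
  · rw [ratBitSize_two_pow]
    simp
  · rw [hsol]
    ext x
    constructor
    · intro hx
      obtain ⟨y, hy⟩ := hne x hx.1
      exact ⟨(x, y), ⟨hx, hy⟩, rfl⟩
    · rintro ⟨q, hq, rfl⟩
      exact hq.1
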